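/- **Setting.** Formulas are the terms over a countably infinite set of propositional variables in the language $\wedge,\vee,\cdot,\backslash,/,{}^*,0,1$; a sequent $\Gamma\Rightarrow\beta$ consists of a finite sequence $\Gamma$ of formulas and a formula $\beta$. Fix countably infinite disjoint sets of formula metavariables and of sequence metavariables. A *schematic rule* has finitely many premises and a conclusion, each made of a finite sequence of sequence metavariables and metaformulas (terms over the formula metavariables) and a metaformula on the right; its instances arise by instantiating formula metavariables by formulas and sequence metavariables by finite sequences of formulas. A *structural rule* is a schematic rule in which every left-hand side is a sequence of (formula or sequence) metavariables and every right-hand side is a formula metavariable. It is *linear* if the left-hand side of its conclusion consists of pairwise distinct sequence metavariables. The *identity axiom* is $a\Rightarrow a$ for propositional variables $a$. The *principal rules* are the following (premises before the slash; the principal formula is the one in the conclusion that shows the connective; the auxiliary formulas are its displayed constituents in the premises, which for ${*}\mathrm L$ are both $\alpha$ and $\alpha^*$ in the second premise, and for ${*}\mathrm R_1$ are $\beta$ and $\beta^*$): - $0\mathrm L$: $\;/\;\Gamma,0,\Delta\Rightarrow\beta$; $\quad 1\mathrm L$: $\Gamma,\Delta\Rightarrow\beta\;/\;\Gamma,1,\Delta\Rightarrow\beta$;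 $\quad 1\mathrm R$: $\;/\;\Rightarrow 1$; - $\wedge\mathrm L_i$: $\Gamma,\alpha_i,\Delta\Rightarrow\beta\;/\;\Gamma,\alpha_0\wedge\alpha_1,\Delta\Rightarrow\beta$ $(i=0,1)$; $\quad\wedge\mathrm R$: $\Gamma\Rightarrow\beta_0$ and $\Gamma\Rightarrow\beta_1\;/\;\Gamma\Rightarrow\beta_0\wedge\beta_1$; - $\vee\mathrm L$: $\Gamma,\alpha_0,\Delta\Rightarrow\beta$ and $\Gamma,\alpha_1,\Delta\Rightarrow\beta\;/\;\Gamma,\alpha_0\vee\alpha_1,\Delta\Rightarrow\beta$; $\quad\vee\mathrm R_i$: $\Gamma\Rightarrow\beta_i\;/\;\Gamma\Rightarrow\beta_0\vee\beta_1$ $(i=0,1)$; - ${\cdot}\mathrm L$: $\Gamma,\alpha_0,\alpha_1,\Delta\Rightarrow\beta\;/\;\Gamma,\alpha_0\cdot\alpha_1,\Delta\Rightarrow\beta$; $\quad{\cdot}\mathrm R$: $\Gamma\Rightarrow\beta_0$ and $\Delta\Rightarrow\beta_1\;/\;\Gamma,\Delta\Rightarrow\beta_0\cdot\beta_1$; -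 $\backslash\mathrm L$: $\Delta\Rightarrow\alpha_0$ and $\Gamma,\alpha_1,\Sigma\Rightarrow\beta\;/\;\Gamma,\Delta,\alpha_0\backslash\alpha_1,\Sigma\Rightarrow\beta$; $\quad\backslash\mathrm R$: $\beta_0,\Gamma\Rightarrow\beta_1\;/\;\Gamma\Rightarrow\beta_0\backslash\beta_1$; - $/\mathrm L$: $\Delta\Rightarrow\alpha_0$ and $\Gamma,\alpha_1,\Sigma\Rightarrow\beta\;/\;\Gamma,\alpha_1/\alpha_0,\Delta,\Sigma\Rightarrow\beta$; $\quad/\mathrm R$: $\Gamma,\beta_0\Rightarrow\beta_1\;/\;\Gamma\Rightarrow\beta_1/\beta_0$; - ${*}\mathrm R_0$: $\;/\;\Rightarrow\beta^*$; $\quad{*}\mathrm R_1$: $\Gamma\Rightarrow\beta$ and $\Delta\Rightarrow\beta^*\;/\;\Gamma,\Delta\Rightarrow\beta^*$; - ${*}\mathrm L_\omega$: $\Gamma,\alpha^{(n)},\Delta\Rightarrow\beta$ for all $n\in\mathbb N$ $\;/\;\Gamma,\alpha^*,\Delta\Rightarrow\beta$, where $\alpha^{(n)}$ is the sequence $\alpha,\dots,\alpha$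 of length $n$; - ${*}\mathrm L$: $\Gamma,\Delta\Rightarrow\beta$ and $\Gamma,\alpha,\alpha^*,\Delta\Rightarrow\beta\;/\;\Gamma,\alpha^*,\Delta\Rightarrow\beta$. A *preproof* is a possibly non-wellfounded tree whose nodes are labelled by rule instances (each given with its instantiation), such that the children of a node carry exactly the premises of its instance; it is a preproof of the sequent at its root. A *branch* is an infinite path from the root. For a rule instance, an occurrence in a premise is an *immediate ancestor* of an occurrence in the conclusion if the former is auxiliary and the latter principal, or both come from the same formula metavariable, or both come from the same position in the instantiation of the same sequence metavariable (structural rules have no principal or auxiliary formulas). A *thread* along a branch chooses, at each node of a non-empty interval of the branch, a formula occurrence in the sequent at this node, so that each chosen occurrence is an immediate ancestor of the previous one. A thread is *progressing* if it has a suffix that always denotes one and the same formula of the form $\alpha^*$, always on the left-hand side, and that is principal infinitely often. For a set $\mathcal R$ of linear rules, the *wellfounded system plus $\mathcal R$* has as rules the identity axiom, $\mathcal R$, and all principal rules except ${*}\mathrm L$; its proofs are the preproofs without branches. The *non-wellfounded system plus $\mathcal R$* has as rules the identity axiom, $\mathcal R$, and all principal rules except ${*}\mathrm L_\omega$; its proofs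 are the preproofs in which every branch has a progressing thread. **Theorem.** Let $\mathcal R$ be any set of linear rules. For every sequent $S$, there is a proof of $S$ in the wellfounded system plus $\mathcal R$ if and only if there is a proof of $S$ in the non-wellfounded system plus $\mathcal R$. -/

import Mathlib

namespace ActionLat

/-- Terms over a set `V` of generators: the absolutely free algebra over the language
`∧, ∨, ·, \, /, *, 0, 1`. `ldiv a b` is `a \ b` and `rdiv b a` is `b / a`. -/
inductive Term (V : Type) : Type
  | var (x : V)
  | zero
  | one
  | meet (a b : Term V)
  | join (a b : Term V)
  | mul (a b : Term V)
  | ldiv (a b : Term V)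
  | rdiv (b a : Term V)
  | star (a : Term V)

/-- The homomorphic extension of a map from the generators to terms. -/
def Term.subst {V W : Type} (σ : V → Term W) : Term V → Term W
  | .var x => σ x
  | .zero => .zero
  | .one => .one
  | .meet a b => .meet (a.subst σ) (b.subst σ)
  | .join a b => .join (a.subst σ) (b.subst σ)
  | .mul a b => .mul (a.subst σ) (b.subst σ)
  | .ldiv a b => .ldiv (a.subst σ) (b.subst σ)
  | .rdiv b a => .rdiv (b.subst σ) (a.subst σ)
  | .star a => .star (a.subst σ)

/-- Propositional variables (a countably infinite set). -/
abbrev PVar : Type := ℕ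

/-- Formula metavariables (a countably infinite set). -/
abbrev FVar : Type := ℕ

/-- Sequence metavariables (a countably infinite set). -/
abbrev SVar : Type := ℕ

abbrev Formula : Type := Term PVar

abbrev Metaformula : Type := Term FVar

/-- A sequent `ant ⇒ suc`. -/
structure Sequent where
  ant : List Formula
  suc : Formula

/-- Positions in a sequent: `left i` is the `i`-th formula of the antecedent (counted from `0`),
`right` is the succedent (the position written `-1` on paper). -/
inductive Occ : Type
  | left (i : ℕ)
  | right

/-- The formula at a position; `none` if the position is not a formula occurrence of `S`. -/
def Sequent.get (S : Sequent) : Occ → Option Formula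
  | .left i => S.ant[i]?
  | .right => some S.suc

/-! ### Schematic rules -/

/-- A metaformula displayed in a schematic rule, together with the information whether it is boxed.
The boxed formula of the conclusion is the principal one, those of the premises are the auxiliary
ones. -/
structure Marked where
  fm : Metaformula
  boxed : Bool

/-- A boxed metaformula. -/
def box (φ : Metaformula) : Marked := ⟨φ, true⟩

/-- A metaformula without a box. -/
def plain (φ : Metaformula) : Marked := ⟨φ, false⟩

/-- The entries of the antecedent of a schematic sequent. -/
inductive Item : Type
  | seq (x : SVar)
  | form (m : Marked)

structure SchematicSequent where
  ant : List Item
  suc : Marked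

/-- A schematic rule with finitely many premises. -/
structure SchematicRule where
  premises : List SchematicSequent
  concl : SchematicSequent

/-- A metavariable instantiation. -/
structure Instantiation where
  form : FVar → Formula
  seq : SVar → List Formula

def Item.inst (σ : Instantiation) : Item → List Formula
  | .seq x => σ.seq x
  | .form m => [m.fm.subst σ.form]

def SchematicSequent.inst (σ : Instantiation) (S : SchematicSequent) : Sequent :=
  ⟨S.ant.flatMap (Item.inst σ), S.suc.fm.subst σ.form⟩

/-- Where a formula occurrence of an instantiated schematic sequent comes from: from the `p`-th
formula of the instantiation of the sequence metavariable `x`, or from a displayed metaformula. -/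
inductive Origin : Type
  | seq (x : SVar) (p : ℕ)
  | form (m : Marked)

def Item.origins (σ : Instantiation) : Item → List Origin
  | .seq x => (List.range (σ.seq x).length).map (Origin.seq x)
  | .form m => [Origin.form m]

/-- The origin of the formula occurrence at a position of `S.inst σ`. -/
def SchematicSequent.origin (σ : Instantiation) (S : SchematicSequent) : Occ → Option Origin
  | .left i => (S.ant.flatMap (Item.origins σ))[i]?
  | .right => some (.form S.suc)

/-- `u.Ancestor v`: an occurrence in a premise with origin `v` is an immediate ancestor of an
occurrence in the conclusion with origin `u`. The three cases: principal and auxiliary formula; the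
same formula metavariable; the same position in the same sequence metavariable. -/
def Origin.Ancestor (u v : Origin) : Prop :=
  (∃ φ ψ, u = .form (box φ) ∧ v = .form (box ψ)) ∨
  (∃ (a : FVar) (m m' : Marked), u = .form m ∧ v = .form m' ∧ m.fm = .var a ∧ m'.fm = .var a) ∨
  (∃ x p, u = .seq x p ∧ v = .seq x p)

/-! ### Structural rules -/

/-- The entry is a metavariable (for formulas or for sequences), with no box. -/
def Item.IsMetavariable (t : Item) : Prop :=
  (∃ x, t = .seq x) ∨ (∃ a, t = .form (plain (.var a)))

/-- Only metavariables occur, the succedent is a formula metavariable, and nothing is boxed. -/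
def SchematicSequent.IsStructural (S : SchematicSequent) : Prop :=
  (∀ t ∈ S.ant, t.IsMetavariable) ∧ ∃ a, S.suc = plain (.var a)

def SchematicRule.IsStructural (r : SchematicRule) : Prop :=
  (∀ S ∈ r.premises, S.IsStructural) ∧ r.concl.IsStructural

/-- A linear rule is a structural rule for which the antecedent of the conclusion consists of
pairwise distinct sequence metavariables. -/
def SchematicRule.IsLinear (r : SchematicRule) : Prop :=
  r.IsStructural ∧ ∃ xs : List SVar, xs.Nodup ∧ r.concl.ant = xs.map Item.seq

/-! ### Principal rules

In the rules below `Γ, Δ, Σ` are the sequence metavariables `0, 1, 2`, and the formula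
metavariables are `0, 1` (for `α₀, α₁` or `β₀, β₁` or `α`) and `2` (for an unboxed succedent). -/

/-- `Γ` -/
def sG : Item := .seq 0

/-- `Δ` -/
def sD : Item := .seq 1

/-- `Σ` -/
def sS : Item := .seq 2

/-- The first displayed formula metavariable (`α₀`, `β₀`, `α`). -/
def m0 : Metaformula := .var 0

/-- The second displayed formula metavariable (`α₁`, `β₁`). -/
def m1 : Metaformula := .var 1

/-- The formula metavariable of an unboxed succedent (`β`). -/
def mS : Metaformula := .var 2

/-- A boxed metaformula as an entry of an antecedent. -/
def bx (φ : Metaformula) : Item := .form (box φ)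

def zeroL : SchematicRule := ⟨[], ⟨[sG, bx .zero, sD], plain mS⟩⟩

def oneL : SchematicRule := ⟨[⟨[sG, sD], plain mS⟩], ⟨[sG, bx .one, sD], plain mS⟩⟩

def oneR : SchematicRule := ⟨[], ⟨[], box .one⟩⟩

def meetL0 : SchematicRule :=
  ⟨[⟨[sG, bx m0, sD], plain mS⟩], ⟨[sG, bx (.meet m0 m1), sD], plain mS⟩⟩

def meetL1 : SchematicRule :=
  ⟨[⟨[sG, bx m1, sD], plain mS⟩], ⟨[sG, bx (.meet m0 m1), sD], plain mS⟩⟩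

def meetR : SchematicRule :=
  ⟨[⟨[sG], box m0⟩, ⟨[sG], box m1⟩], ⟨[sG], box (.meet m0 m1)⟩⟩

def joinL : SchematicRule :=
  ⟨[⟨[sG, bx m0, sD], plain mS⟩, ⟨[sG, bx m1, sD], plain mS⟩],
    ⟨[sG, bx (.join m0 m1), sD], plain mS⟩⟩

def joinR0 : SchematicRule := ⟨[⟨[sG], box m0⟩], ⟨[sG], box (.join m0 m1)⟩⟩

def joinR1 : SchematicRule := ⟨[⟨[sG], box m1⟩], ⟨[sG], box (.join m0 m1)⟩⟩

def mulL : SchematicRule :=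
  ⟨[⟨[sG, bx m0, bx m1, sD], plain mS⟩], ⟨[sG, bx (.mul m0 m1), sD], plain mS⟩⟩

def mulR : SchematicRule :=
  ⟨[⟨[sG], box m0⟩, ⟨[sD], box m1⟩], ⟨[sG, sD], box (.mul m0 m1)⟩⟩

def ldivL : SchematicRule :=
  ⟨[⟨[sD], box m0⟩, ⟨[sG, bx m1, sS], plain mS⟩],
    ⟨[sG, sD, bx (.ldiv m0 m1), sS], plain mS⟩⟩

def rdivL : SchematicRule :=
  ⟨[⟨[sD], box m0⟩, ⟨[sG, bx m1, sS], plain mS⟩],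
    ⟨[sG, bx (.rdiv m1 m0), sD, sS], plain mS⟩⟩

def ldivR : SchematicRule := ⟨[⟨[bx m0, sG], box m1⟩], ⟨[sG], box (.ldiv m0 m1)⟩⟩

def rdivR : SchematicRule := ⟨[⟨[sG, bx m0], box m1⟩], ⟨[sG], box (.rdiv m1 m0)⟩⟩

def starR0 : SchematicRule := ⟨[], ⟨[], box (.star m0)⟩⟩

def starR1 : SchematicRule :=
  ⟨[⟨[sG], box m0⟩, ⟨[sD], box (.star m0)⟩], ⟨[sG, sD], box (.star m0)⟩⟩

/-- The rule `*L` of the non-wellfounded systems. -/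
def starLRule : SchematicRule :=
  ⟨[⟨[sG, sD], plain mS⟩, ⟨[sG, bx m0, bx (.star m0), sD], plain mS⟩],
    ⟨[sG, bx (.star m0), sD], plain mS⟩⟩

/-- The conclusion of the `ω`-rule `*L_ω`. -/
def starLOmegaConcl : SchematicSequent := ⟨[sG, bx (.star m0), sD], plain mS⟩

/-- The `n`-th premise of the `ω`-rule `*L_ω`. -/
def starLOmegaPremise (n : ℕ) : SchematicSequent :=
  ⟨[sG] ++ List.replicate n (bx m0) ++ [sD], plain mS⟩

/-- The principal rules other than `*L` and `*L_ω`. -/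
def principalRules : Set SchematicRule :=
  {zeroL, oneL, oneR, meetL0, meetL1, meetR, joinL, joinR0, joinR1, mulL, mulR, ldivL, rdivL,
    ldivR, rdivR, starR0, starR1}

/-! ### Rules and their instances -/

/-- Rules: the identity axiom, the schematic rules, and the `ω`-rule. -/
inductive Rule : Type
  | ident
  | schematic (r : SchematicRule)
  | starLOmega

/-- An instance of a rule, together with the instantiation that gives it. -/
inductive Inference : Type
  | ident (a : PVar)
  | schematic (r : SchematicRule) (σ : Instantiation)
  | starLOmega (σ : Instantiation)

namespace Inference

/-- The rule of which this is an instance. -/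
def rule : Inference → Rule
  | .ident _ => .ident
  | .schematic r _ => .schematic r
  | .starLOmega _ => .starLOmega

/-- The conclusion. -/
def concl : Inference → Sequent
  | .ident a => ⟨[.var a], .var a⟩
  | .schematic r σ => r.concl.inst σ
  | .starLOmega σ => starLOmegaConcl.inst σ

/-- The `n`-th premise, counted from `0`; `none` if there is no such premise. -/
def premise : Inference → ℕ → Option Sequent
  | .ident _, _ => none
  | .schematic r σ, n => r.premises[n]?.map (SchematicSequent.inst σ)
  | .starLOmega σ, n => some ((starLOmegaPremise n).inst σ)

/-- The origin of an occurrence in the conclusion. -/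
def conclOrigin : Inference → Occ → Option Origin
  | .ident _, _ => none
  | .schematic r σ, o => r.concl.origin σ o
  | .starLOmega σ, o => starLOmegaConcl.origin σ o

/-- The origin of an occurrence in the `n`-th premise. -/
def premiseOrigin : Inference → ℕ → Occ → Option Origin
  | .ident _, _, _ => none
  | .schematic r σ, n, o => r.premises[n]?.bind fun S => S.origin σ o
  | .starLOmega σ, n, o => (starLOmegaPremise n).origin σ o

/-- The occurrence `o` in the conclusion is the principal one. -/
def IsPrincipal (ι : Inference) (o : Occ) : Prop :=
  ∃ φ, ι.conclOrigin o = some (.form (box φ))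

/-- The occurrence `o'` in the `n`-th premise is an immediate ancestor of the occurrence `o` in the
conclusion. -/
def IsImmediateAncestor (ι : Inference) (n : ℕ) (o' o : Occ) : Prop :=
  ∃ u v, ι.conclOrigin o = some u ∧ ι.premiseOrigin n o' = some v ∧ u.Ancestor v

end Inference

/-! ### Preproofs -/

/-- A preproof over a set of rules: a possibly non-wellfounded tree of inferences. The nodes are the
`w : List ℕ` with `tree w ≠ none`; the children of `w` are the nodes `w ++ [n]`, and they carry
exactly the premises of the inference at `w`. The sequent at `w` is the conclusion of the inference
at `w`. -/
structure Preproof (𝓡 : Set Rule) where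
  tree : List ℕ → Option Inference
  root_mem : (tree []).isSome
  prefix_closed : ∀ w n, tree w = none → tree (w ++ [n]) = none
  rule_mem : ∀ w ι, tree w = some ι → ι.rule ∈ 𝓡
  children : ∀ w ι, tree w = some ι → ∀ n, (tree (w ++ [n])).map Inference.concl = ι.premise n

namespace Preproof

variable {𝓡 : Set Rule}

/-- `π` is a preproof of `S`: the sequent at the root is `S`. -/
def Proves (π : Preproof 𝓡) (S : Sequent) : Prop :=
  (π.tree []).map Inference.concl = some S

/-- The (infinite) branches: sequences of nodes that start at the root, each a child of the
previous one. -/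
def IsBranch (π : Preproof 𝓡) (b : ℕ → List ℕ) : Prop :=
  b 0 = [] ∧ ∀ i, (π.tree (b i)).isSome ∧ ∃ n, b (i + 1) = b i ++ [n]

/-- `t`, restricted to `I`, is a thread in `(π, b)`. The values of `t` outside `I` are irrelevant. -/
def IsThread (π : Preproof 𝓡) (b : ℕ → List ℕ) (I : Set ℕ) (t : ℕ → Occ) : Prop :=
  I.Nonempty ∧ I.OrdConnected ∧
  (∀ i ∈ I, ∃ ι, π.tree (b i) = some ι ∧ (ι.concl.get (t i)).isSome) ∧
  (∀ i ∈ I, i + 1 ∈ I → ∃ ι n, π.tree (b i) = some ι ∧ b (i + 1) = b i ++ [n] ∧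
    ι.IsImmediateAncestor n (t (i + 1)) (t i))

/-- A `*`-thread: it always denotes the same `*`-formula, in the antecedent. -/
def IsStarThread (π : Preproof 𝓡) (b : ℕ → List ℕ) (I : Set ℕ) (t : ℕ → Occ) : Prop :=
  π.IsThread b I t ∧ ∃ α : Formula, ∀ i ∈ I, t i ≠ .right ∧
    ∃ ι, π.tree (b i) = some ι ∧ ι.concl.get (t i) = some (.star α)

/-- The thread `(I', t')` is a suffix of the thread `(I, t)`. -/
def IsSuffix (I' : Set ℕ) (t' : ℕ → Occ) (I : Set ℕ) (t : ℕ → Occ) : Prop :=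
  I' ⊆ I ∧ (∀ i ∈ I', ∀ j ∈ I, i ≤ j → j ∈ I') ∧ ∀ i ∈ I', t' i = t i

/-- The thread `(I, t)` is progressing: some suffix is a `*`-thread that is principal infinitely
often. -/
def IsProgressingThread (π : Preproof 𝓡) (b : ℕ → List ℕ) (I : Set ℕ) (t : ℕ → Occ) : Prop :=
  π.IsThread b I t ∧ ∃ I' t', IsSuffix I' t' I t ∧ π.IsStarThread b I' t' ∧
    {i ∈ I' | ∃ ι, π.tree (b i) = some ι ∧ ι.IsPrincipal (t' i)}.Infinite

/-- `(π, b)` has a progressing thread. -/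
def IsProgressing (π : Preproof 𝓡) (b : ℕ → List ℕ) : Prop :=
  ∃ I t, π.IsProgressingThread b I t

end Preproof

/-! ### Proof systems -/

/-- A proof system: a set of rules and a condition on the branches of preproofs. -/
structure ProofSystem where
  rules : Set Rule
  branchCondition : Preproof rules → (ℕ → List ℕ) → Prop

/-- There is a proof of `S`: a preproof of `S` all of whose branches satisfy the branch
condition. -/
def ProofSystem.Provable (G : ProofSystem) (S : Sequent) : Prop :=
  ∃ π : Preproof G.rules, π.Proves S ∧ ∀ b, π.IsBranch b → G.branchCondition π b

/-- The wellfounded system plus `R`: identity, the rules in `R`, and all principal rules except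
`*L`. No branch is allowed. -/
def wellfoundedSystem (R : Set SchematicRule) : ProofSystem where
  rules := {.ident, .starLOmega} ∪ Rule.schematic '' (principalRules ∪ R)
  branchCondition _ _ := False

/-- The non-wellfounded system plus `R`: identity, the rules in `R`, and all principal rules except
`*L_ω`. Every branch must have a progressing thread. -/
def nonWellfoundedSystem (R : Set SchematicRule) : ProofSystem where
  rules := {.ident, .schematic starLRule} ∪ Rule.schematic '' (principalRules ∪ R)
  branchCondition π b := π.IsProgressing b

end ActionLat

namespace ActionLat

/-! ### Derivability in the wellfounded sense -/

/-! Both notions of proof are compared with the inductive predicate `Derivable` over the rules of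
the wellfounded system.

From a non-wellfounded proof to a derivation: suppose that the root is not derivable. Reading the
ω-rule backwards (`derivable_of_expand`, `exists_refuted`), every left `α*` can be labelled by some
`n` such that the sequent stays underivable when each `α*` is replaced by `n` copies of `α`. Such
labels can be pushed upwards to some premise of every inference (`exists_refuted_premise`). A linear
or principal rule other than `*L` stays an instance of itself after the replacement, because it only
affects pairwise distinct sequence metavariables; so some premise with inherited labels is
underivable. At `*L` with principal label `0` the left premise is taken, and with label `k + 1` the
right one, where `α*` gets label `k`. On the resulting branch the labels along a progressing thread
never increase and drop infinitely often, which is impossible in `ℕ`.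

Conversely, an ω-inference becomes an infinite spine of instances of `*L`, the `n`-th premise of the
ω-rule being proved to the left of the `n`-th instance (`HasProof.starLOmega`). The spine follows
the principal `α*`; any other branch eventually stays in a subproof. -/

/-- The least set of sequents closed under all inferences of the rules in `𝓡`. -/
inductive Derivable (𝓡 : Set Rule) : Sequent → Prop
  | infer (ι : Inference) (hι : ι.rule ∈ 𝓡)
      (h : ∀ n S, ι.premise n = some S → Derivable 𝓡 S) : Derivable 𝓡 ι.concl

/-! ### Replacing `*`-formulas by powers -/

/-- Replace `α*` by the sequence `α, …, α` of the given length; other formulas are kept. -/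
def starPower : Formula → Option ℕ → List Formula
  | .star α, some n => List.replicate n α
  | φ, _ => [φ]

@[simp] lemma starPower_none (φ : Formula) : starPower φ none = [φ] := by
  cases φ <;> rfl

@[simp] lemma starPower_star (α : Formula) (n : ℕ) :
    starPower (.star α) (some n) = List.replicate n α := rfl

lemma starPower_of_ne {φ : Formula} (h : ∀ α, φ ≠ .star α) (o : Option ℕ) :
    starPower φ o = [φ] := by
  cases φ <;> first | rfl | exact absurd rfl (h _)

/-- Replace the `*`-formulas of a sequence by powers, with lengths depending on the position. -/
def expand : List Formula → (ℕ → Option ℕ) → List Formula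
  | [], _ => []
  | φ :: Γ, p => starPower φ (p 0) ++ expand Γ fun i => p (i + 1)

lemma expand_append (Γ Δ : List Formula) (p : ℕ → Option ℕ) :
    expand (Γ ++ Δ) p = expand Γ p ++ expand Δ fun i => p (Γ.length + i) := by
  induction Γ generalizing p with
  | nil => simp [expand]
  | cons φ Γ ih =>
    simp only [List.cons_append, expand, ih, List.append_assoc, List.length_cons]
    congr 3
    funext i
    congr 1
    omega

/-- Labels matter only through their effect, so they are free at positions that carry no
`*`-formula. -/
lemma expand_congr {Γ : List Formula} {p q : ℕ → Option ℕ}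
    (h : ∀ i φ, Γ[i]? = some φ → starPower φ (p i) = starPower φ (q i)) :
    expand Γ p = expand Γ q := by
  induction Γ generalizing p q with
  | nil => rfl
  | cons φ Γ ih =>
    rw [expand, expand, h 0 φ (by simp), ih]
    intro i ψ hi
    exact h (i + 1) ψ (by simpa using hi)

lemma expand_none (Γ : List Formula) : expand Γ (fun _ => none) = Γ := by
  induction Γ with
  | nil => rfl
  | cons φ Γ ih => simp [expand, ih]

/-- Iterated use of `*L_ω`: it suffices to derive all total refinements of a partial
replacement. -/
lemma derivable_of_expand {𝓡 : Set Rule} (hω : Rule.starLOmega ∈ 𝓡) {β : Formula}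
    {Γ : List Formula} {p : ℕ → Option ℕ} (P Q : List Formula)
    (h : ∀ a : ℕ → ℕ, (∀ i n, p i = some n → a i = n) →
      Derivable 𝓡 ⟨P ++ expand Γ (fun i => some (a i)) ++ Q, β⟩) :
    Derivable 𝓡 ⟨P ++ expand Γ p ++ Q, β⟩ := by
  induction Γ generalizing p P with
  | nil => simpa [expand] using h (fun i => (p i).getD 0) (fun i n hi => by simp [hi])
  | cons φ Γ ih =>
    -- Once the head is labelled by `n`, its replacement joins the context `P`, and the induction
    -- hypothesis handles the tail.
    have key : ∀ n, (∀ m, p 0 = some m → n = m) → Derivable 𝓡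
        ⟨P ++ starPower φ (some n) ++ expand Γ (fun i => p (i + 1)) ++ Q, β⟩ := by
      intro n hn
      refine ih (P ++ starPower φ (some n)) fun a ha => ?_
      have := h (fun i => Nat.casesOn i n a) (by
        rintro (_ | i) m hm
        · exact hn m hm
        · exact ha i m hm)
      simpa [expand, List.append_assoc] using this
    rw [expand]
    cases hp : p 0 with
    | some n =>
      have := key n (by simp [hp])
      simpa [List.append_assoc] using this
    | none =>
      have key' := fun n => key n (by simp [hp])
      by_cases hφ : ∃ α, φ = .star α
      · obtain ⟨α, rfl⟩ := hφ
        -- The `n`-th premise of this ω-inference is the sequent in which the still unlabelled head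
        -- gets label `n`.
        let σ : Instantiation := ⟨fun v => if v = 0 then α else β,
          fun x => if x = 0 then P else expand Γ (fun i => p (i + 1)) ++ Q⟩
        have := Derivable.infer (𝓡 := 𝓡) (.starLOmega σ) hω (by
          intro n S hS
          simp only [Inference.premise, Option.some.injEq] at hS
          subst hS
          have := key' n
          simpa [starLOmegaPremise, SchematicSequent.inst, Item.inst, sG, sD, bx, box, plain, m0,
            mS, Term.subst, σ, List.flatMap_replicate, List.flatten_replicate_singleton] using this)
        simpa [Inference.concl, starLOmegaConcl, SchematicSequent.inst, Item.inst, sG, sD, bx, box,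
          plain, m0, mS, Term.subst, σ] using this
      -- A head that is not a `*`-formula ignores its label, so `0` is an arbitrary choice.
      · have := key' 0
        rw [starPower_of_ne (by simpa using hφ)] at this
        simpa [List.append_assoc] using this

/-! ### Replacements in instances of schematic sequents -/

@[simp] lemma Item.length_origins (σ : Instantiation) (t : Item) :
    (t.origins σ).length = (t.inst σ).length := by
  cases t <;> simp [Item.origins, Item.inst]

/-- The instance of an item after the replacement of `*`-formulas given by a function of the
origin. -/
def Item.instExpand (σ : Instantiation) (c : Origin → Option ℕ) : Item → List Formula
  | .seq x => expand (σ.seq x) fun i => c (.seq x i)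
  | .form m => starPower (m.fm.subst σ.form) (c (.form m))

/-- The instantiation with `*`-formulas replaced in the sequence metavariables. -/
def Instantiation.expand (σ : Instantiation) (c : Origin → Option ℕ) : Instantiation :=
  ⟨σ.form, fun x => ActionLat.expand (σ.seq x) fun i => c (.seq x i)⟩

/-- Translates between labels attached to origins, which can be compared across conclusion and
premises, and labels attached to positions. -/
lemma flatMap_instExpand (σ : Instantiation) (c : Origin → Option ℕ) (T : List Item) :
    T.flatMap (Item.instExpand σ c) =
      expand (T.flatMap (Item.inst σ)) fun i => (T.flatMap (Item.origins σ))[i]?.bind c := by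
  induction T with
  | nil => rfl
  | cons t T ih =>
    simp only [List.flatMap_cons, expand_append, ih]
    congr 1
    · cases t with
      | seq x =>
        refine expand_congr fun i φ hi => ?_
        have hi' : i < (σ.seq x).length := (List.getElem?_eq_some_iff.1 hi).1
        rw [List.getElem?_append_left (by simpa [Item.origins] using hi')]
        simp [Item.origins, hi']
      | form m => simp [Item.instExpand, Item.inst, Item.origins, expand]
    · congr 1
      funext i
      rw [← Item.length_origins, List.getElem?_append_right (by omega), Nat.add_sub_cancel_left]

/-- If only formulas inside sequence metavariables are replaced, the replacement amounts to a change
of instantiation; this is why rule instances survive it. -/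
lemma inst_expand_eq {σ : Instantiation} {c : Origin → Option ℕ} (hc : ∀ m, c (.form m) = none)
    (T : List Item) : T.flatMap (Item.inst (σ.expand c)) = T.flatMap (Item.instExpand σ c) := by
  congr 1
  funext t
  cases t <;> simp [Item.inst, Item.instExpand, Instantiation.expand, hc]

lemma getElem?_origins_form {σ : Instantiation} {T : List Item} {i : ℕ} {m : Marked}
    (h : (T.flatMap (Item.origins σ))[i]? = some (.form m)) :
    .form m ∈ T ∧ (T.flatMap (Item.inst σ))[i]? = some (m.fm.subst σ.form) := by
  induction T generalizing i with
  | nil => simp at h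
  | cons t T ih =>
    rw [List.flatMap_cons] at h ⊢
    rcases lt_or_ge i (t.origins σ).length with hi | hi
    · rw [List.getElem?_append_left hi] at h
      rw [List.getElem?_append_left (by simpa using hi)]
      cases t with
      | seq x =>
        have := List.mem_of_getElem? h
        simp [Item.origins] at this
      | form m' =>
        obtain rfl : i = 0 := by simpa [Item.origins] using hi
        simp only [Item.origins, List.getElem?_cons_zero, Option.some.injEq, Origin.form.injEq] at h
        subst h
        simp [Item.inst]
    · rw [List.getElem?_append_right hi] at h
      rw [List.getElem?_append_right (by simpa using hi), ← Item.length_origins]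
      exact ⟨List.mem_cons_of_mem _ (ih h).1, (ih h).2⟩

/-- Distinct items make the passage from positions to origins injective, so a labelling of the
positions of a conclusion is well defined on origins. -/
lemma nodup_origins {σ : Instantiation} {T : List Item} (hT : T.Nodup) :
    (T.flatMap (Item.origins σ)).Nodup := by
  rw [List.nodup_flatMap]
  refine ⟨fun t _ => ?_, hT.imp fun {s t} hst => ?_⟩
  · cases t with
    | seq x =>
      exact List.Nodup.map (fun i j h => (Origin.seq.inj h).2) List.nodup_range
    | form m => simp [Item.origins]
  · cases s <;> cases t <;>
      simp only [Function.onFun, Item.origins, List.disjoint_left, List.mem_map, List.mem_range,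
        List.mem_singleton] <;> grind

open Classical in
/-- A labelling of positions, as a labelling of the origins of these positions. -/
noncomputable def originLabel (O : List Origin) (a : ℕ → ℕ) (o : Origin) : Option ℕ :=
  if h : ∃ i, O[i]? = some o then some (a h.choose) else none

lemma originLabel_eq {O : List Origin} (hO : O.Nodup) (a : ℕ → ℕ) {i : ℕ} {o : Origin}
    (hi : O[i]? = some o) : originLabel O a o = some (a i) := by
  have h : ∃ i, O[i]? = some o := ⟨i, hi⟩
  rw [originLabel, dif_pos h]
  obtain ⟨h1, h1'⟩ := List.getElem?_eq_some_iff.1 h.choose_spec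
  obtain ⟨h2, h2'⟩ := List.getElem?_eq_some_iff.1 hi
  rw [(hO.getElem_inj_iff (hi := h1) (hj := h2)).1 (h1'.trans h2'.symm)]

lemma getElem?_origins_of_inst {σ : Instantiation} {T : List Item} {i : ℕ} {φ : Formula}
    (h : (T.flatMap (Item.inst σ))[i]? = some φ) :
    ∃ o, (T.flatMap (Item.origins σ))[i]? = some o := by
  have hi := (List.getElem?_eq_some_iff.1 h).1
  have : i < (T.flatMap (Item.origins σ)).length := by
    simpa [List.length_flatMap] using hi
  exact ⟨_, List.getElem?_eq_getElem this⟩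

/-! ### Left-hand sides of conclusions -/

/-- The items are pairwise distinct, and no displayed metaformula has a `*`-formula as an
instance. -/
def StarFree (T : List Item) : Prop :=
  T.Nodup ∧ ∀ m, Item.form m ∈ T → ∀ (σ : FVar → Formula) α, m.fm.subst σ ≠ .star α

/-- The only principal rules displaying a `*`-formula on the left of the conclusion are `*L` and
`*L_ω`, both excluded from this set. -/
lemma starFree_principal {r : SchematicRule} (hr : r ∈ principalRules) : StarFree r.concl.ant := by
  simp only [principalRules, Set.mem_insert_iff, Set.mem_singleton_iff] at hr
  rcases hr with h | h | h | h | h | h | h | h | h | h | h | h | h | h | h | h | h <;> subst h <;>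
    simp [StarFree, zeroL, oneL, oneR, meetL0, meetL1, meetR, joinL, joinR0, joinR1, mulL, mulR,
      ldivL, rdivL, ldivR, rdivR, starR0, starR1, sG, sD, sS, bx, box, Term.subst]

lemma SchematicRule.IsLinear.starFree {r : SchematicRule} (hr : r.IsLinear) :
    StarFree r.concl.ant := by
  obtain ⟨-, xs, hxs, h⟩ := hr
  rw [h]
  exact ⟨hxs.map fun x y h => Item.seq.inj h, by simp⟩

variable {𝓡 : Set Rule}

/-! ### From non-wellfounded proofs to derivations -/

/-- The sequent is not derivable after replacing its left `*`-formulas by powers of the given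
lengths. -/
def Refuted (𝓡 : Set Rule) (S : Sequent) (a : ℕ → ℕ) : Prop :=
  ¬ Derivable 𝓡 ⟨expand S.ant fun i => some (a i), S.suc⟩

lemma exists_refuted (hω : Rule.starLOmega ∈ 𝓡) {Γ : List Formula} {β : Formula}
    {p : ℕ → Option ℕ} (h : ¬ Derivable 𝓡 ⟨expand Γ p, β⟩) :
    ∃ a, (∀ i n, p i = some n → a i = n) ∧ Refuted 𝓡 ⟨Γ, β⟩ a := by
  by_contra! hc
  refine h ?_
  simpa using derivable_of_expand (p := p) hω [] [] fun a ha => by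
    simpa [Refuted] using hc a ha

/-- Every immediate ancestor of a left `*`-formula that is the same left `*`-formula has a label
that is not larger, and smaller if the descendant is principal. -/
def Inference.Decreases (ι : Inference) (n : ℕ) (S : Sequent) (a a' : ℕ → ℕ) : Prop :=
  ∀ i j α, ι.concl.get (.left i) = some (.star α) → S.get (.left j) = some (.star α) →
    ι.IsImmediateAncestor n (.left j) (.left i) →
    a' j ≤ a i ∧ (ι.IsPrincipal (.left i) → a' j < a i)

lemma expand_eq_flatMap_instExpand {σ : Instantiation} {T : List Item} {a : ℕ → ℕ}
    {c : Origin → Option ℕ}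
    (h : ∀ i o φ, (T.flatMap (Item.origins σ))[i]? = some o →
      (T.flatMap (Item.inst σ))[i]? = some φ → starPower φ (c o) = starPower φ (some (a i))) :
    expand (T.flatMap (Item.inst σ)) (fun i => some (a i)) =
      T.flatMap (Item.instExpand σ c) := by
  rw [flatMap_instExpand]
  refine expand_congr fun i φ hi => ?_
  obtain ⟨o, ho⟩ := getElem?_origins_of_inst hi
  rw [ho, Option.bind_some, h i o φ ho hi]

/-- The replaced conclusion is the conclusion of the same rule under a modified instantiation, so
one of its premises is underivable. Copies of one sequence metavariable in that premise inherit the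
same labels; the remaining `*`-formulas are labelled by `exists_refuted`. -/
lemma exists_refuted_premise_of_starFree (hω : Rule.starLOmega ∈ 𝓡) {r : SchematicRule}
    (hr : Rule.schematic r ∈ 𝓡) (hT : StarFree r.concl.ant) (σ : Instantiation) {a : ℕ → ℕ}
    (ha : Refuted 𝓡 (r.concl.inst σ) a) :
    ∃ n S a', (Inference.schematic r σ).premise n = some S ∧ Refuted 𝓡 S a' ∧
      (Inference.schematic r σ).Decreases n S a a' := by
  set O := r.concl.ant.flatMap (Item.origins σ) with hO
  have hnd : O.Nodup := nodup_origins hT.1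
  let c : Origin → Option ℕ
    | .form _ => none
    | .seq x p => originLabel O a (.seq x p)
  have hconcl : ⟨expand (r.concl.inst σ).ant fun i => some (a i), (r.concl.inst σ).suc⟩ =
      r.concl.inst (σ.expand c) := by
    have : expand (r.concl.ant.flatMap (Item.inst σ)) (fun i => some (a i)) =
        r.concl.ant.flatMap (Item.instExpand σ c) := by
      refine expand_eq_flatMap_instExpand fun i o φ ho hφ => ?_
      cases o with
      | seq x p => simp only [c, originLabel_eq hnd a ho]
      | form m =>
        obtain ⟨hm, hm'⟩ := getElem?_origins_form ho
        obtain rfl : m.fm.subst σ.form = φ := Option.some.inj (hm'.symm.trans hφ)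
        rw [starPower_of_ne (hT.2 m hm _), starPower_of_ne (hT.2 m hm _)]
    simp only [SchematicSequent.inst, this, inst_expand_eq (c := c) (fun _ => rfl)]
    rfl
  have : ∃ S ∈ r.premises, ¬ Derivable 𝓡 (S.inst (σ.expand c)) := by
    by_contra! hall
    refine ha ?_
    rw [hconcl]
    refine Derivable.infer (.schematic r (σ.expand c)) hr fun n S hS => ?_
    simp only [Inference.premise, Option.map_eq_some_iff] at hS
    obtain ⟨S', hS', rfl⟩ := hS
    exact hall S' (List.mem_of_getElem? hS')
  obtain ⟨S, hS, hnS⟩ := this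
  obtain ⟨n, hn⟩ := List.mem_iff_getElem?.1 hS
  have hnS' : ¬ Derivable 𝓡 ⟨expand (S.ant.flatMap (Item.inst σ))
      (fun i => (S.ant.flatMap (Item.origins σ))[i]?.bind c), S.suc.fm.subst σ.form⟩ := by
    rw [← flatMap_instExpand, ← inst_expand_eq (fun _ => rfl)]
    exact hnS
  obtain ⟨a', ha', hbad⟩ := exists_refuted hω hnS'
  refine ⟨n, S.inst σ, a', by simp [Inference.premise, hn], hbad, ?_⟩
  rintro i j α hi - ⟨u, v, hu, hv, huv⟩
  simp only [Inference.conclOrigin, SchematicSequent.origin] at hu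
  simp only [Inference.premiseOrigin, hn, Option.bind_some, SchematicSequent.origin] at hv
  -- A left `*`-formula of the conclusion must lie inside a sequence metavariable, so only the third
  -- kind of ancestry remains and the label is copied.
  have hform : ∀ m, u ≠ .form m := by
    rintro m rfl
    obtain ⟨hm, hm'⟩ := getElem?_origins_form hu
    exact hT.2 m hm _ α (Option.some.inj (hm'.symm.trans hi))
  obtain ⟨φ, -, h, -⟩ | ⟨b, m, -, h, -⟩ | ⟨x, p, rfl, rfl⟩ := huv
  · exact absurd h (hform _)
  · exact absurd h (hform _)
  · have : a' j = a i := ha' j _ (by rw [hv]; exact originLabel_eq hnd a hu)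
    refine ⟨this.le, ?_⟩
    rintro ⟨φ, hφ⟩
    simp only [Inference.conclOrigin, SchematicSequent.origin] at hφ
    exact absurd (Option.some.inj (hu.symm.trans hφ)) (hform _)

lemma Term.ne_star {V : Type} (α : Term V) : α ≠ .star α := by
  intro h
  have := congrArg sizeOf h
  simp at this

/-- No inference is needed here: after the replacement, the antecedent of the conclusion equals that
of one premise, since `α^0` is empty and `α^(k+1)` is `α, α^k`. -/
lemma exists_refuted_premise_starL (hω : Rule.starLOmega ∈ 𝓡) (σ : Instantiation) {a : ℕ → ℕ}
    (ha : Refuted 𝓡 (starLRule.concl.inst σ) a) :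
    ∃ n S a', (Inference.schematic starLRule σ).premise n = some S ∧ Refuted 𝓡 S a' ∧
      (Inference.schematic starLRule σ).Decreases n S a a' := by
  classical
  set T := starLRule.concl.ant with hT
  set O := T.flatMap (Item.origins σ) with hO
  have hnd : O.Nodup := nodup_origins (by simp [hT, starLRule, sG, sD, bx])
  have hform : ∀ {i : ℕ} {m : Marked}, O[i]? = some (.form m) → m = box (.star m0) := by
    intro i m h
    have h' : Item.form m ∈ T := (getElem?_origins_form h).1
    simpa [hT, starLRule, sG, sD, bx] using h'
  have hi₀ : O[(σ.seq 0).length]? = some (.form (box (.star m0))) := by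
    simp [hO, hT, starLRule, sG, sD, bx, Item.origins]
  set N := a (σ.seq 0).length with hN
  have hconcl : expand (T.flatMap (Item.inst σ)) (fun i => some (a i)) =
      T.flatMap (Item.instExpand σ (originLabel O a)) :=
    expand_eq_flatMap_instExpand fun i o φ ho _ => by rw [originLabel_eq hnd a ho]
  -- The auxiliary `α*` gets the predecessor of the principal label, the auxiliary `α` is kept, and
  -- the context inherits its labels.
  let c : Origin → Option ℕ
    | .form m => if m = box (.star m0) then some (N - 1) else none
    | .seq x p => originLabel O a (.seq x p)
  have key : ∀ n S, starLRule.premises[n]? = some S → S.suc = plain mS →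
      (∀ m ψ, n = 1 → .form m ∈ S.ant → m = box ψ → ψ = m0 ∨ ψ = .star m0) →
      (n ≠ 1 → ∀ m, .form m ∉ S.ant) → (n = 1 → 0 < N) →
      T.flatMap (Item.instExpand σ (originLabel O a)) = S.ant.flatMap (Item.instExpand σ c) →
      ∃ n S a', (Inference.schematic starLRule σ).premise n = some S ∧ Refuted 𝓡 S a' ∧
        (Inference.schematic starLRule σ).Decreases n S a a' := by
    intro n S hn hsuc h1 h0 hpos heq
    have hnS : ¬ Derivable 𝓡 ⟨expand (S.ant.flatMap (Item.inst σ))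
        (fun i => (S.ant.flatMap (Item.origins σ))[i]?.bind c), S.suc.fm.subst σ.form⟩ := by
      rw [← flatMap_instExpand, ← heq, ← hconcl, hsuc]
      exact ha
    obtain ⟨a', ha', hbad⟩ := exists_refuted hω hnS
    refine ⟨n, S.inst σ, a', by simp [Inference.premise, hn], hbad, ?_⟩
    rintro i j α hi hj ⟨u, v, hu, hv, huv⟩
    simp only [Inference.conclOrigin, SchematicSequent.origin] at hu
    simp only [Inference.premiseOrigin, hn, Option.bind_some, SchematicSequent.origin] at hv
    obtain ⟨φ, ψ, rfl, rfl⟩ | ⟨b, m, m', rfl, -, hm, -⟩ | ⟨x, p, rfl, rfl⟩ := huv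
    · have hφ := hform hu
      obtain ⟨hψ, hψ'⟩ := getElem?_origins_form hv
      have hn1 : n = 1 := by
        by_contra hn1
        exact h0 hn1 _ hψ
      have hii : a i = N := by
        have h1 := originLabel_eq hnd a hu
        rw [hφ, originLabel_eq hnd a hi₀] at h1
        exact (Option.some.inj h1).symm
      have hα : (box φ).fm.subst σ.form = .star α :=
        Option.some.inj ((getElem?_origins_form hu).2.symm.trans hi)
      have hα' : (box ψ).fm.subst σ.form = .star α :=
        Option.some.inj (hψ'.symm.trans hj)
      rw [hφ] at hα
      have hjj : a' j = N - 1 := by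
        -- The auxiliary `α` may itself be a `*`-formula with an uncontrolled label, but it differs
        -- from `α*`, so a thread with constant formula cannot pass through it.
        obtain rfl | rfl := h1 _ ψ hn1 hψ rfl
        · simp only [box, m0, Term.subst, Term.star.injEq] at hα hα'
          exact absurd (hα.symm.trans hα') (Term.ne_star α)
        · exact ha' j _ (by simp [hv, c])
      have := hpos hn1
      exact ⟨by omega, fun _ => by omega⟩
    · rw [hform hu] at hm
      simp [box] at hm
    · have : a' j = a i := ha' j _ (by rw [hv]; exact originLabel_eq hnd a hu)
      refine ⟨this.le, ?_⟩
      rintro ⟨φ, hφ⟩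
      simp only [Inference.conclOrigin, SchematicSequent.origin] at hφ
      simpa using hu.symm.trans hφ
  have hlab : originLabel O a (.form ⟨.star (.var 0), true⟩) = some N := originLabel_eq hnd a hi₀
  rcases Nat.eq_zero_or_pos N with h0 | hpos
  · refine key 0 ⟨[sG, sD], plain mS⟩ rfl rfl (by simp) (by simp [sG, sD]) (by simp) ?_
    simp [hT, starLRule, sG, sD, bx, box, m0, Item.instExpand, Term.subst, c, hlab, h0]
  · refine key 1 ⟨[sG, bx m0, bx (.star m0), sD], plain mS⟩ rfl rfl ?_ (by simp) (fun _ => hpos) ?_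
    · rintro m ψ - hm rfl
      simpa [sG, sD, bx, box] using hm
    · obtain ⟨k, hk⟩ : ∃ k, N = k + 1 := ⟨N - 1, by omega⟩
      simp [hT, starLRule, sG, sD, bx, box, m0, Item.instExpand, Term.subst, c, hlab, hk,
        List.replicate_succ]

lemma exists_refuted_premise {R : Set SchematicRule} (hR : ∀ r ∈ R, r.IsLinear) {ι : Inference}
    (hι : ι.rule ∈ (nonWellfoundedSystem R).rules) {a : ℕ → ℕ}
    (ha : Refuted (wellfoundedSystem R).rules ι.concl a) :
    ∃ n S a', ι.premise n = some S ∧ Refuted (wellfoundedSystem R).rules S a' ∧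
      ι.Decreases n S a a' := by
  have hω : Rule.starLOmega ∈ (wellfoundedSystem R).rules := by simp [wellfoundedSystem]
  cases ι with
  | ident x =>
    refine absurd ?_ ha
    exact Derivable.infer (.ident x) (by simp [wellfoundedSystem, Inference.rule])
      (by simp [Inference.premise])
  | starLOmega σ => simp [nonWellfoundedSystem, Inference.rule] at hι
  | schematic r σ =>
    by_cases hr : r = starLRule
    · subst hr
      exact exists_refuted_premise_starL hω σ ha
    · have hr' : r ∈ principalRules ∪ R := by
        simpa [nonWellfoundedSystem, Inference.rule, hr] using hι
      refine exists_refuted_premise_of_starFree hω (r := r) ?_ ?_ σ ha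
      · exact Or.inr ⟨r, hr', rfl⟩
      · exact hr'.elim starFree_principal fun h => (hR r h).starFree

lemma Preproof.tree_child {π : Preproof 𝓡} {w : List ℕ} {ι : Inference} (h : π.tree w = some ι)
    {n : ℕ} {S : Sequent} (hS : ι.premise n = some S) :
    ∃ ι', π.tree (w ++ [n]) = some ι' ∧ ι'.concl = S := by
  have := π.children w ι h n
  rw [hS, Option.map_eq_some_iff] at this
  exact this

lemma exists_forall_succ {X : Type*} {r : X → X → Prop} (h : ∀ x, ∃ y, r x y) (x : X) :
    ∃ s : ℕ → X, s 0 = x ∧ ∀ i, r (s i) (s (i + 1)) := by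
  choose f hf using h
  exact ⟨fun i => Nat.rec x (fun _ y => f y) i, rfl, fun i => hf _⟩

theorem derivable_of_nonWellfounded {R : Set SchematicRule} (hR : ∀ r ∈ R, r.IsLinear)
    {S : Sequent} (h : (nonWellfoundedSystem R).Provable S) :
    Derivable (wellfoundedSystem R).rules S := by
  obtain ⟨π, hπ, hbr⟩ := h
  by_contra hS
  have hω : Rule.starLOmega ∈ (wellfoundedSystem R).rules := by simp [wellfoundedSystem]
  rw [← show (⟨expand S.ant fun _ => none, S.suc⟩ : Sequent) = S by rw [expand_none]] at hS
  obtain ⟨a₀, -, ha₀⟩ := exists_refuted hω hS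
  obtain ⟨ι₀, hι₀, hS₀⟩ := Option.map_eq_some_iff.1 hπ
  -- The states of the walk: a node with its inference and a refuting labelling of its conclusion.
  let X := {x : List ℕ × Inference × (ℕ → ℕ) //
    π.tree x.1 = some x.2.1 ∧ Refuted (wellfoundedSystem R).rules x.2.1.concl x.2.2}
  have hstep : ∀ x : X, ∃ y : X, ∃ n, y.1.1 = x.1.1 ++ [n] ∧
      x.1.2.1.Decreases n y.1.2.1.concl x.1.2.2 y.1.2.2 := by
    rintro ⟨⟨w, ι, a⟩, hw, ha⟩
    obtain ⟨n, S, a', hn, ha', hd⟩ := exists_refuted_premise hR (π.rule_mem w ι hw) ha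
    obtain ⟨ι', hι', rfl⟩ := π.tree_child hw hn
    exact ⟨⟨⟨w ++ [n], ι', a'⟩, hι', ha'⟩, n, rfl, hd⟩
  obtain ⟨s, hs0, hs⟩ := exists_forall_succ hstep
    ⟨⟨[], ι₀, a₀⟩, hι₀, by rw [hS₀]; exact ha₀⟩
  have hb : π.IsBranch fun i => (s i).1.1 :=
    ⟨by simp [hs0], fun i => ⟨by simp [(s i).2.1], (hs i).imp fun n hn => hn.1⟩⟩
  obtain ⟨I₀, t₀, -, I, t, -, ⟨⟨⟨k, hk⟩, hconn, -, hanc⟩, α, hα⟩, hinf⟩ := hbr _ hb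
  -- Being principal infinitely often makes the interval of the thread unbounded.
  have hI : ∀ i ≥ k, i ∈ I := fun i hi => by
    obtain ⟨j, hj, hij⟩ := hinf.exists_gt i
    exact hconn.out hk hj.1 ⟨hi, hij.le⟩
  have hleft : ∀ i ≥ k, ∃ p, t i = .left p := fun i hi => by
    have := (hα i (hI i hi)).1
    cases h : t i with
    | left p => exact ⟨p, rfl⟩
    | right => exact absurd h this
  have hget : ∀ i ≥ k, (s i).1.2.1.concl.get (t i) = some (.star α) := fun i hi => by
    obtain ⟨-, ι, hι, h⟩ := hα i (hI i hi)
    rw [(s i).2.1, Option.some.injEq] at hι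
    rwa [hι]
  -- The label along the thread; the value on the right is a dummy, as the thread stays on the left
  -- from `k` on.
  let g : ℕ → ℕ := fun i => match t i with
    | .left p => (s i).1.2.2 p
    | .right => 0
  have hg : ∀ i ≥ k, g (i + 1) ≤ g i ∧ ((s i).1.2.1.IsPrincipal (t i) → g (i + 1) < g i) := by
    intro i hi
    obtain ⟨n, hn, hd⟩ := hs i
    obtain ⟨ι, n', hι, hn', ha⟩ := hanc i (hI i hi) (hI (i + 1) (by omega))
    rw [(s i).2.1, Option.some.injEq] at hι
    obtain rfl : n = n' := by
      have := hn.symm.trans hn'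
      simpa using this
    have h1 := hget i hi
    have h2 := hget (i + 1) (by omega)
    obtain ⟨p, hp⟩ := hleft i hi
    obtain ⟨q, hq⟩ := hleft (i + 1) (by omega)
    rw [hp] at h1 ha ⊢
    rw [hq] at h2 ha
    have := hd p q α h1 h2 (hι ▸ ha)
    simpa only [g, hp, hq] using this
  have hmono : ∀ m ≥ k, ∀ i, m ≤ i → g i ≤ g m := fun m hm i hi =>
    Nat.le_induction le_rfl (fun j hj ih => ((hg j (hm.trans hj)).1).trans ih) i hi
  -- The next principal step after a minimum of `g` would go below that minimum.
  obtain ⟨m, hm, hmin⟩ : ∃ m, k ≤ m ∧ ∀ i ≥ k, g m ≤ g i := by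
    obtain ⟨m, hm⟩ := exists_minimal_of_wellFoundedLT (fun v => ∃ i ≥ k, g i = v) ⟨g k, k, le_rfl, rfl⟩
    obtain ⟨⟨i, hi, rfl⟩, h⟩ := hm
    exact ⟨i, hi, fun j hj => (le_total (g i) (g j)).elim id fun h' => h ⟨j, hj, rfl⟩ h'⟩
  obtain ⟨i, ⟨-, ι, hι, hpr⟩, hmi⟩ := hinf.exists_gt m
  rw [(s i).2.1, Option.some.injEq] at hι
  have h1 := (hg i (by omega)).2 (hι ▸ hpr)
  have h2 := hmono m hm i hmi.le
  have h3 := hmin (i + 1) (by omega)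
  omega

/-! ### From wellfounded proofs to derivations -/

theorem derivable_of_wellfounded {R : Set SchematicRule} {S : Sequent}
    (h : (wellfoundedSystem R).Provable S) : Derivable (wellfoundedSystem R).rules S := by
  obtain ⟨π, hπ, hbr⟩ := h
  by_contra hS
  obtain ⟨ι₀, hι₀, rfl⟩ := Option.map_eq_some_iff.1 hπ
  let X := {w : List ℕ // ∃ ι, π.tree w = some ι ∧ ¬ Derivable (wellfoundedSystem R).rules ι.concl}
  have hstep : ∀ x : X, ∃ y : X, ∃ n, y.1 = x.1 ++ [n] := by
    rintro ⟨w, ι, hw, hι⟩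
    have : ∃ n S, ι.premise n = some S ∧ ¬ Derivable (wellfoundedSystem R).rules S := by
      by_contra! hc
      exact hι (.infer ι (π.rule_mem w ι hw) hc)
    obtain ⟨n, S, hn, hnd⟩ := this
    obtain ⟨ι', hι', rfl⟩ := π.tree_child hw hn
    exact ⟨⟨w ++ [n], ι', hι', hnd⟩, n, rfl⟩
  obtain ⟨s, hs0, hs⟩ := exists_forall_succ hstep ⟨[], ι₀, hι₀, hS⟩
  refine hbr (fun i => (s i).1) ⟨by simp [hs0], fun i => ⟨?_, hs i⟩⟩
  obtain ⟨ι, hι, -⟩ := (s i).2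
  simp [hι]

/-! ### From derivations to proofs -/

/-- The node reached after `i` steps of a branch given by its directions. -/
def node (f : ℕ → ℕ) (i : ℕ) : List ℕ := (List.range i).map f

lemma node_zero (f : ℕ → ℕ) : node f 0 = [] := rfl

lemma node_succ (f : ℕ → ℕ) (i : ℕ) : node f (i + 1) = node f i ++ [f i] := by
  simp [node, List.range_succ]

lemma node_succ' (f : ℕ → ℕ) (i : ℕ) : node f (i + 1) = f 0 :: node (fun j => f (j + 1)) i := by
  simp [node, List.range_succ_eq_map, Function.comp_def]

/-- The conditions on preproofs, without the existence of the root. -/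
structure IsPretree (𝓡 : Set Rule) (t : List ℕ → Option Inference) : Prop where
  prefix_closed : ∀ w n, t w = none → t (w ++ [n]) = none
  rule_mem : ∀ w ι, t w = some ι → ι.rule ∈ 𝓡
  children : ∀ w ι, t w = some ι → ∀ n, (t (w ++ [n])).map Inference.concl = ι.premise n

/-- There is a preproof such that the sequences of inferences and of directions of every branch
satisfy `C`. -/
def HasProof (𝓡 : Set Rule) (C : (ℕ → Inference) → (ℕ → ℕ) → Prop) (S : Sequent) : Prop :=
  ∃ t, IsPretree 𝓡 t ∧ (t []).map Inference.concl = some S ∧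
    ∀ f ι, (∀ i, t (node f i) = some (ι i)) → C ι f

lemma HasProof.exists_preproof {C : (ℕ → Inference) → (ℕ → ℕ) → Prop} {S : Sequent}
    (h : HasProof 𝓡 C S) : ∃ π : Preproof 𝓡, π.Proves S ∧ ∀ b, π.IsBranch b →
      ∃ ι f, C ι f ∧ (∀ i, π.tree (b i) = some (ι i)) ∧ ∀ i, b (i + 1) = b i ++ [f i] := by
  obtain ⟨t, ht, hroot, hC⟩ := h
  refine ⟨⟨t, by rw [← Option.isSome_map (f := Inference.concl), hroot]; rfl,
    ht.1, ht.2, ht.3⟩, hroot, ?_⟩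
  rintro b ⟨hb0, hb⟩
  choose ι hι using fun i => Option.isSome_iff_exists.1 (hb i).1
  choose f hf using fun i => (hb i).2
  have : ∀ i, b i = node f i := fun i => by
    induction i with
    | zero => exact hb0
    | succ i ih => rw [hf, node_succ, ih]
  exact ⟨ι, f, hC f ι fun i => by rw [← this]; exact hι i, hι, hf⟩

/-- Put an inference below the trees of its premises. -/
def graft (ι : Inference) (t : ℕ → List ℕ → Option Inference) : List ℕ → Option Inference
  | [] => some ι
  | n :: w => t n w

/-- A branch of the grafted tree is, after its first step, a branch of one of the subtrees, so it
suffices that `C` passes from tails to whole branches. -/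
lemma HasProof.infer {C : (ℕ → Inference) → (ℕ → ℕ) → Prop}
    (hC : ∀ ι f, C (fun i => ι (i + 1)) (fun i => f (i + 1)) → C ι f) {ι : Inference}
    (hι : ι.rule ∈ 𝓡) (h : ∀ n S, ι.premise n = some S → HasProof 𝓡 C S) :
    HasProof 𝓡 C ι.concl := by
  have : ∀ n, ∃ t, IsPretree 𝓡 t ∧ (t []).map Inference.concl = ι.premise n ∧
      ∀ f ι, (∀ i, t (node f i) = some (ι i)) → C ι f := fun n => by
    cases hn : ι.premise n with
    | none => exact ⟨fun _ => none, ⟨by simp, by simp, by simp⟩, rfl, fun f ι h => by simp at h⟩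
    | some S => exact h n S hn
  choose t ht hroot hbr using this
  refine ⟨graft ι t, ⟨?_, ?_, ?_⟩, rfl, fun f ι' h => ?_⟩
  · rintro (_ | ⟨m, w⟩) n hw
    · simp [graft] at hw
    · exact (ht m).1 w n hw
  · rintro (_ | ⟨m, w⟩) ι' hw
    · simp only [graft, Option.some.injEq] at hw
      exact hw ▸ hι
    · exact (ht m).2 w ι' hw
  · rintro (_ | ⟨m, w⟩) ι' hw n
    · simp only [graft, Option.some.injEq] at hw
      exact hw ▸ hroot n
    · exact (ht m).3 w ι' hw n
  · refine hC ι' f (hbr (f 0) _ _ fun i => ?_)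
    have := h (i + 1)
    rwa [node_succ'] at this

/-- The tree whose rightmost branch consists of the inferences `ι k`, the left subtree at the
`k`-th of them being `t k`. -/
def comb (ι : ℕ → Inference) (t : ℕ → List ℕ → Option Inference) :
    ℕ → List ℕ → Option Inference
  | k, [] => some (ι k)
  | k, 0 :: w => t k w
  | k, 1 :: w => comb ι t (k + 1) w
  | _, (_ + 2) :: _ => none

/-- A branch either is the spine, covered by `hspine`, or leaves it after finitely many steps into
some `t k`; `hC` then restores those steps. -/
lemma HasProof.comb {C : (ℕ → Inference) → (ℕ → ℕ) → Prop}
    (hC : ∀ ι f, C (fun i => ι (i + 1)) (fun i => f (i + 1)) → C ι f) {ι : ℕ → Inference}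
    (hι : ∀ k, (ι k).rule ∈ 𝓡) (h0 : ∀ k, ∃ S, (ι k).premise 0 = some S ∧ HasProof 𝓡 C S)
    (h1 : ∀ k, (ι k).premise 1 = some (ι (k + 1)).concl)
    (h2 : ∀ k n, (ι k).premise (n + 2) = none) (hspine : C ι fun _ => 1) :
    HasProof 𝓡 C (ι 0).concl := by
  choose S hS t ht hroot hbr using h0
  refine ⟨ActionLat.comb ι t 0, ⟨?_, ?_, ?_⟩, rfl, ?_⟩
  -- Following the spine shifts the index of the comb, so the induction on the node needs an
  -- arbitrary starting index.
  · generalize 0 = k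
    intro w
    induction w generalizing k with
    | nil => simp [ActionLat.comb]
    | cons m w ih =>
      intro n hw
      match m with
      | 0 => exact (ht k).1 w n hw
      | 1 => exact ih (k + 1) n hw
      | m + 2 => rfl
  · generalize 0 = k
    intro w
    induction w generalizing k with
    | nil =>
      intro ι' hw
      simp only [ActionLat.comb, Option.some.injEq] at hw
      exact hw ▸ hι k
    | cons m w ih =>
      intro ι' hw
      match m with
      | 0 => exact (ht k).2 w ι' hw
      | 1 => exact ih (k + 1) ι' hw
      | m + 2 => simp [ActionLat.comb] at hw
  · generalize 0 = k
    intro w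
    induction w generalizing k with
    | nil =>
      intro ι' hw n
      simp only [ActionLat.comb, Option.some.injEq] at hw
      subst hw
      match n with
      | 0 => exact (hroot k).trans (hS k).symm
      | 1 => simp [ActionLat.comb, h1]
      | n + 2 => simp [ActionLat.comb, h2]
    | cons m w ih =>
      intro ι' hw n
      match m with
      | 0 => exact (ht k).3 w ι' hw n
      | 1 => exact ih (k + 1) ι' hw n
      | m + 2 => simp [ActionLat.comb] at hw
  · intro f ι' h
    by_cases hf : ∀ i, f i = 1
    · obtain rfl : f = fun _ => 1 := funext hf
      have hnode : ∀ i k, ActionLat.comb ι t k (node (fun _ => 1) i) = some (ι (k + i)) := by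
        intro i
        induction i with
        | zero => intro k; rfl
        | succ i ih =>
          intro k
          rw [node_succ']
          simp only [ActionLat.comb]
          rw [ih]
          congr 2
          omega
      obtain rfl : ι' = ι := funext fun i => by
        have := (h i).symm.trans (hnode i 0)
        simpa using this
      exact hspine
    -- The induction is on some step `m` off the direction `1`, not necessarily the first; leaving
    -- earlier is treated separately.
    · push Not at hf
      obtain ⟨m, hm⟩ := hf
      revert h
      generalize 0 = k
      intro h
      induction m generalizing f ι' k with
      | zero =>
        refine hC ι' f (hbr k _ _ fun i => ?_)
        have hz : f 0 = 0 := by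
          have := h 1
          rw [node_succ', node_zero] at this
          match hf : f 0 with
          | 0 => rfl
          | 1 => exact absurd hf hm
          | n + 2 => simp [hf, ActionLat.comb] at this
        have := h (i + 1)
        rwa [node_succ', hz] at this
      | succ m ih =>
        by_cases hz1 : f 0 = 1
        · refine hC ι' f (ih (fun i => f (i + 1)) _ hm (k + 1) fun i => ?_)
          have := h (i + 1)
          rwa [node_succ', hz1] at this
        · refine hC ι' f (hbr k _ _ fun i => ?_)
          have hz : f 0 = 0 := by
            have := h 1
            rw [node_succ', node_zero] at this
            match hf : f 0 with
            | 0 => rfl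
            | 1 => exact absurd hf hz1
            | n + 2 => simp [hf, ActionLat.comb] at this
          have := h (i + 1)
          rwa [node_succ', hz] at this

/-! ### Progressing branches and the construction of proofs -/

/-- Some `*`-thread on the left is principal infinitely often. -/
def Progresses (ι : ℕ → Inference) (f : ℕ → ℕ) : Prop :=
  ∃ (k : ℕ) (p : ℕ → ℕ) (α : Formula), (∀ i ≥ k, (ι i).concl.get (.left (p i)) = some (.star α) ∧
    (ι i).IsImmediateAncestor (f i) (.left (p (i + 1))) (.left (p i))) ∧
    ∀ m, ∃ i ≥ m, (ι i).IsPrincipal (.left (p i))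

lemma Progresses.of_tail {ι : ℕ → Inference} {f : ℕ → ℕ}
    (h : Progresses (fun i => ι (i + 1)) fun i => f (i + 1)) : Progresses ι f := by
  obtain ⟨k, p, α, h1, h2⟩ := h
  refine ⟨k + 1, fun i => p (i - 1), α, fun i hi => ?_, fun m => ?_⟩
  · obtain ⟨j, rfl⟩ : ∃ j, i = j + 1 := ⟨i - 1, by omega⟩
    exact h1 j (by omega)
  · obtain ⟨i, hi, hp⟩ := h2 m
    exact ⟨i + 1, by omega, hp⟩

lemma Progresses.isProgressing {π : Preproof 𝓡} {b : ℕ → List ℕ} {ι : ℕ → Inference} {f : ℕ → ℕ}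
    (h : Progresses ι f) (hι : ∀ i, π.tree (b i) = some (ι i))
    (hf : ∀ i, b (i + 1) = b i ++ [f i]) : π.IsProgressing b := by
  obtain ⟨k, p, α, h1, h2⟩ := h
  have hth : π.IsThread b (Set.Ici k) fun i => .left (p i) :=
    ⟨⟨k, le_refl k⟩, Set.ordConnected_Ici, fun i hi => ⟨ι i, hι i, by simp [(h1 i hi).1]⟩,
      fun i hi _ => ⟨ι i, f i, hι i, hf i, (h1 i hi).2⟩⟩
  refine ⟨Set.Ici k, fun i => .left (p i), hth, Set.Ici k, fun i => .left (p i),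
    ⟨subset_rfl, fun i _ j hj _ => hj, fun _ _ => rfl⟩,
    ⟨hth, α, fun i hi => ⟨by simp, ι i, hι i, (h1 i hi).1⟩⟩, ?_⟩
  refine Set.infinite_of_forall_exists_gt fun m => ?_
  obtain ⟨i, hi, hp⟩ := h2 (max k (m + 1))
  exact ⟨i, ⟨(le_max_left _ _).trans hi, ι i, hι i, hp⟩, (le_max_right _ _).trans hi⟩

theorem Derivable.wellfounded {R : Set SchematicRule} {S : Sequent}
    (h : Derivable (wellfoundedSystem R).rules S) : (wellfoundedSystem R).Provable S := by
  have : HasProof (wellfoundedSystem R).rules (fun _ _ => False) S := by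
    induction h with
    | infer ι hι _ ih => exact HasProof.infer (fun _ _ => id) hι ih
  obtain ⟨π, hπ, hb⟩ := this.exists_preproof
  exact ⟨π, hπ, fun b hbr => by obtain ⟨_, _, h, -⟩ := hb b hbr; exact h⟩

/-- The `ω`-rule is simulated by an infinite sequence of instances of `*L`. -/
lemma HasProof.starLOmega (h𝓡 : Rule.schematic starLRule ∈ 𝓡) (σ : Instantiation)
    (h : ∀ n, HasProof 𝓡 Progresses ((starLOmegaPremise n).inst σ)) :
    HasProof 𝓡 Progresses (starLOmegaConcl.inst σ) := by
  -- After `k` unfoldings, `k` copies of `α` have been absorbed into `Γ`; the left premise is then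
  -- the `k`-th premise of the ω-rule.
  let τ : ℕ → Instantiation := fun k => ⟨σ.form, fun x =>
    if x = 0 then σ.seq 0 ++ List.replicate k (σ.form 0) else σ.seq x⟩
  have key := HasProof.comb (𝓡 := 𝓡) (C := Progresses) (fun _ _ => Progresses.of_tail)
    (ι := fun k => .schematic starLRule (τ k)) (fun _ => h𝓡) (fun k => ⟨_, rfl, ?_⟩)
    (fun k => ?_) (fun k n => by simp [Inference.premise, starLRule]) ?_
  · have e : (Inference.schematic starLRule (τ 0)).concl = starLOmegaConcl.inst σ := by
      simp [Inference.concl, starLRule, starLOmegaConcl, SchematicSequent.inst, Item.inst, sG, sD,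
        bx, box, τ]
    rwa [e] at key
  · have := h k
    simpa [starLOmegaPremise, SchematicSequent.inst, Item.inst, sG, sD, bx, box, m0, Term.subst, τ,
      List.flatMap_replicate, List.flatten_replicate_singleton] using this
  · simp [Inference.premise, Inference.concl, starLRule, SchematicSequent.inst, Item.inst, sG, sD,
      bx, box, m0, Term.subst, τ, List.replicate_succ']
  · have ho : ∀ k, (Inference.schematic starLRule (τ k)).conclOrigin
        (.left ((σ.seq 0).length + k)) = some (.form (box (.star m0))) := fun k => by
      simp [Inference.conclOrigin, SchematicSequent.origin, starLRule, sG, sD, bx, Item.origins, τ]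
    -- Each unfolding puts one more `α` in front of `α*`, so its position moves right by one; it is
    -- principal at every step of the spine.
    refine ⟨0, fun k => (σ.seq 0).length + k, σ.form 0, fun k _ => ⟨?_, _, _, ho k, ?_,
      Or.inl ⟨_, .star m0, rfl, rfl⟩⟩, fun m => ⟨m, le_rfl, _, ho m⟩⟩
    · simp [Inference.concl, Sequent.get, starLRule, SchematicSequent.inst, Item.inst, sG, sD, bx,
        box, m0, Term.subst, τ]
    · simp [Inference.premiseOrigin, SchematicSequent.origin, starLRule, sG, sD, bx, Item.origins,
        τ, ← add_assoc]

theorem Derivable.nonWellfounded {R : Set SchematicRule} {S : Sequent}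
    (h : Derivable (wellfoundedSystem R).rules S) : (nonWellfoundedSystem R).Provable S := by
  have : HasProof (nonWellfoundedSystem R).rules Progresses S := by
    induction h with
    | infer ι hι _ ih =>
      cases ι with
      | starLOmega σ =>
        exact HasProof.starLOmega (by simp [nonWellfoundedSystem]) σ fun n => ih n _ rfl
      | ident a =>
        exact HasProof.infer (fun _ _ => Progresses.of_tail)
          (by simp [nonWellfoundedSystem, Inference.rule]) ih
      | schematic r σ =>
        refine HasProof.infer (fun _ _ => Progresses.of_tail) (Or.inr ?_) ih
        exact hι.resolve_left (by simp [Inference.rule])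
  obtain ⟨π, hπ, hb⟩ := this.exists_preproof
  refine ⟨π, hπ, fun b hbr => ?_⟩
  obtain ⟨ι, f, hp, hι, hf⟩ := hb b hbr
  exact hp.isProgressing hι hf

end ActionLat

theorem theoremt (R : Set ActionLat.SchematicRule) (hR : ∀ r ∈ R, r.IsLinear)
    (S : ActionLat.Sequent) :
    (ActionLat.wellfoundedSystem R).Provable S ↔ (ActionLat.nonWellfoundedSystem R).Provable S :=
  ⟨fun h => (ActionLat.derivable_of_wellfounded h).nonWellfounded,
    fun h => (ActionLat.derivable_of_nonWellfounded hR h).wellfounded⟩
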